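/- All graphs are finite and simple. For a graph $G$ and a set $S\subseteq V(G)$ with $|S|\ge 2$, an $S$-tree is a subgraph $T$ of $G$ that is a tree with $S\subseteq V(T)$; two $S$-trees $T,T'$ are internally disjoint if $E(T)\cap E(T')=\varnothing$ and $V(T)\cap V(T')=S$. Let $\kappa(S)$ be the maximum number of pairwise internally disjoint $S$-trees in $G$. For a connected graph $G$ with at least three vertices let $\kappa_3(G)=\min\{\kappa(S): S\subseteq V(G),\ |S|=3\}$; put $\kappa_3(G)=1$ if $G$ is connected with fewer than three vertices, and $\kappa_3(G)=0$ if $G$ is disconnected. The lexicographic product $G\circ H$ has vertex set $V(G)\times V(H)$, and $(u,v)$, $(u',v')$ are adjacent if and only if $uu'\in E(G)$, or $u=u'$ and $vv'\in E(H)$. Let $P_n$ denote the path with $n$ vertices. **Proposition 2.3.** Let $H$ be a connected graph and let $n\ge 2$. Then $$\kappa_3(P_n\circ H)\ \ge\ |V(H)|.$$ Moreover, the bound is sharp: for every $n\ge 4$, $\kappa_3(P_n\circ P_3)=3=|V(P_3)|$. -/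

import Mathlib

namespace SimpleGraph

/-- The lexicographic product `G ∘ H`: the vertices are the pairs `(u, v)`, and `(u, v)`, `(u', v')`
are adjacent iff `u u'` is an edge of `G`, or `u = u'` and `v v'` is an edge of `H`. -/
def lexProd {V W : Type*} (G : SimpleGraph V) (H : SimpleGraph W) : SimpleGraph (V × W) where
  Adj p q := G.Adj p.1 q.1 ∨ (p.1 = q.1 ∧ H.Adj p.2 q.2)
  symm := ⟨by
    rintro p q (h | ⟨h, h'⟩)
    · exact Or.inl h.symm
    · exact Or.inr ⟨h.symm, h'.symm⟩⟩
  loopless := ⟨by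
    rintro p (h | ⟨-, h⟩)
    · exact G.irrefl h
    · exact H.irrefl h⟩

/-- An `S`-tree (Steiner tree connecting `S`): a subgraph of `G` that is a tree and whose vertex
set contains `S`. -/
def IsSteinerTree {V : Type*} (G : SimpleGraph V) (S : Finset V) (T : G.Subgraph) : Prop :=
  T.coe.IsTree ∧ (S : Set V) ⊆ T.verts

/-- Two `S`-trees are internally disjoint if they have no common edge and their common vertices
are exactly those of `S`. -/
def InternallyDisjoint {V : Type*} (G : SimpleGraph V) (S : Finset V) (T T' : G.Subgraph) : Prop :=
  T.edgeSet ∩ T'.edgeSet = ∅ ∧ T.verts ∩ T'.verts = (S : Set V)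

/-- `G` contains `r` (distinct) pairwise internally disjoint `S`-trees. -/
def HasDisjointSteinerTrees {V : Type*} (G : SimpleGraph V) (S : Finset V) (r : ℕ) : Prop :=
  ∃ T : Fin r → G.Subgraph, Function.Injective T ∧ (∀ i, G.IsSteinerTree S (T i)) ∧
    ∀ i j, i ≠ j → G.InternallyDisjoint S (T i) (T j)

/-- The generalized local connectivity `κ(S)`: the maximum number of internally disjoint `S`-trees
(on a finite vertex set the supremum is a maximum, see `isGreatest_genLocalConn`). -/
noncomputable def genLocalConn {V : Type*} (G : SimpleGraph V) (S : Finset V) : ℕ :=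
  sSup {r : ℕ | G.HasDisjointSteinerTrees S r}

/-- The supremum that defines `κ(S)` is attained on finite graphs. -/
theorem isGreatest_genLocalConn {V : Type*} [Finite V] (G : SimpleGraph V) (S : Finset V) :
    IsGreatest {r : ℕ | G.HasDisjointSteinerTrees S r} (G.genLocalConn S) := by
  have hb : BddAbove {r : ℕ | G.HasDisjointSteinerTrees S r} := by
    refine ⟨Nat.card G.Subgraph, ?_⟩
    rintro r ⟨T, hT, -⟩
    simpa using Nat.card_le_card_of_injective T hT
  have hne : {r : ℕ | G.HasDisjointSteinerTrees S r}.Nonempty :=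
    ⟨0, fun i => i.elim0, fun i => i.elim0, fun i => i.elim0, fun i => i.elim0⟩
  exact ⟨Nat.sSup_mem hne hb, fun r hr => le_csSup hb hr⟩

open Classical in
/-- The generalized `k`-connectivity `κ_k(G)` of a finite graph, for `k ≥ 2`: the minimum of `κ(S)`
over all sets `S` of exactly `k` vertices. By convention it is `0` if `G` is disconnected, and `1`
if `G` is connected with fewer than `k` vertices. -/
noncomputable def genConn {V : Type*} [Fintype V] (G : SimpleGraph V) (k : ℕ) : ℕ :=
  if ¬ G.Connected then 0
  else if Fintype.card V < k then 1
  else sInf {r : ℕ | ∃ S : Finset V, S.card = k ∧ r = G.genLocalConn S}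

end SimpleGraph

/-! Lower bound: consecutive layers of `P_n ∘ H` are completely joined, so for each `S` of three
vertices one builds disjoint sets `B w` outside `S`, one for each `w : W`, such that `S ∪ B w` is
connected, and takes spanning trees. Two such trees share only `S`, so a common edge would lie
inside `S`; hence it is enough that at most one of them uses such edges
(`hasDisjointSteinerTrees_of_connected`). The sets depend on the layers of the three vertices. Where
layers are far apart, `B w` contains the column `w` between them; adjacent layers need detours
matched by a permutation of `W`, and the exceptional tree uses edges inside `S`. Connectedness of
`H` matters only for two vertices in one layer and the third in an adjacent one.

Upper bound: layer `1` separates layer `0` from layer `2`, so disjoint trees for a set `S` that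
meets both, but not layer `1`, use distinct vertices of layer `1`. -/

namespace SimpleGraph

/-! ### Connected vertex sets and disjoint trees -/

section Linked

variable {V : Type*} {G K : SimpleGraph V} {A : Set V} {u v w : V}

/-- `u` and `v` are joined by a walk of `K` inside the vertex set `A`. -/
def LinkedIn (K : SimpleGraph V) (A : Set V) (u v : V) : Prop :=
  ∃ (hu : u ∈ A) (hv : v ∈ A), (K.induce A).Reachable ⟨u, hu⟩ ⟨v, hv⟩

theorem LinkedIn.refl (hu : u ∈ A) : K.LinkedIn A u u := ⟨hu, hu, Reachable.refl _⟩

theorem LinkedIn.symm (h : K.LinkedIn A u v) : K.LinkedIn A v u :=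
  let ⟨hu, hv, h⟩ := h
  ⟨hv, hu, h.symm⟩

theorem LinkedIn.trans (h : K.LinkedIn A u v) (h' : K.LinkedIn A v w) : K.LinkedIn A u w :=
  let ⟨hu, _, h⟩ := h
  let ⟨_, hw, h'⟩ := h'
  ⟨hu, hw, h.trans h'⟩

theorem Adj.linkedIn (h : K.Adj u v) (hu : u ∈ A) (hv : v ∈ A) : K.LinkedIn A u v :=
  ⟨hu, hv, Adj.reachable (by simpa using h)⟩

theorem LinkedIn.mono (hK : K ≤ G) (h : K.LinkedIn A u v) : G.LinkedIn A u v :=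
  let ⟨hu, hv, h⟩ := h
  ⟨hu, hv, h.mono (comap_monotone _ hK)⟩

theorem connected_induce_of_linkedIn (hu : u ∈ A) (h : ∀ v ∈ A, K.LinkedIn A u v) :
    (K.induce A).Connected :=
  connected_iff_exists_forall_reachable _ |>.2 ⟨⟨u, hu⟩, fun v => (h v v.2).2.2⟩

/-- The graph `G` without the edges that have both ends in `S`. -/
def deleteInside (G : SimpleGraph V) (S : Set V) : SimpleGraph V where
  Adj u v := G.Adj u v ∧ ¬ (u ∈ S ∧ v ∈ S)
  symm := ⟨fun _ _ h => ⟨h.1.symm, fun h' => h.2 h'.symm⟩⟩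
  loopless := ⟨fun _ h => G.irrefl h.1⟩

theorem deleteInside_le (G : SimpleGraph V) (S : Set V) : G.deleteInside S ≤ G :=
  fun _ _ h => h.1

/-- A connected induced subgraph has a spanning tree. -/
theorem exists_subgraph_isTree [Finite V] (hK : K ≤ G) (h : (K.induce A).Connected) :
    ∃ T : G.Subgraph, T.verts = A ∧ T.coe.IsTree ∧ ∀ u v, T.Adj u v → K.Adj u v := by
  obtain ⟨T, hT, hTree⟩ := h.exists_isTree_le
  let T' : G.Subgraph :=
    { verts := A
      Adj := fun u v => ∃ (hu : u ∈ A) (hv : v ∈ A), T.Adj ⟨u, hu⟩ ⟨v, hv⟩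
      adj_sub := fun ⟨_, _, h⟩ => hK (hT h)
      edge_vert := fun ⟨hu, _, _⟩ => hu
      symm := ⟨fun _ _ ⟨hu, hv, h⟩ => ⟨hv, hu, h.symm⟩⟩ }
  have hcoe : T'.coe = T := by
    ext a b
    constructor
    · rintro ⟨_, _, h⟩
      exact h
    · exact fun h => ⟨a.2, b.2, h⟩
  exact ⟨T', rfl, by rwa [hcoe], fun u v ⟨_, _, h⟩ => hT h⟩

/-- Pairwise disjoint sets `B i` that connect `S` without using edges inside `S`, except possibly
for one index, give internally disjoint `S`-trees. -/
theorem hasDisjointSteinerTrees_of_connected [Finite V] {S : Finset V} (hS : 2 ≤ S.card)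
    {ι : Type*} [Fintype ι] (i₀ : ι) (B : ι → Set V)
    (hB : ∀ i j v, v ∈ B i → v ∈ B j → i = j)
    (h₀ : (G.induce ((S : Set V) ∪ B i₀)).Connected)
    (h : ∀ i, i ≠ i₀ → ((G.deleteInside S).induce ((S : Set V) ∪ B i)).Connected) :
    G.HasDisjointSteinerTrees S (Fintype.card ι) := by
  have key : ∀ i, ∃ T : G.Subgraph, T.verts = (S : Set V) ∪ B i ∧ T.coe.IsTree ∧
      ∀ u v, T.Adj u v → i = i₀ ∨ ¬ (u ∈ S ∧ v ∈ S) := by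
    intro i
    by_cases hi : i = i₀
    · subst hi
      obtain ⟨T, h1, h2, -⟩ := exists_subgraph_isTree le_rfl h₀
      exact ⟨T, h1, h2, fun _ _ _ => Or.inl rfl⟩
    · obtain ⟨T, h1, h2, h3⟩ := exists_subgraph_isTree (G.deleteInside_le S) (h i hi)
      exact ⟨T, h1, h2, fun u v huv => Or.inr (h3 u v huv).2⟩
  choose T hV hT hE using key
  have hverts : ∀ i j, i ≠ j → (T i).verts ∩ (T j).verts = (S : Set V) := by
    intro i j hij
    rw [hV, hV]
    ext v
    constructor
    · rintro ⟨h1 | h1, h2 | h2⟩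
      · exact h1
      · exact h1
      · exact h2
      · exact absurd (hB i j v h1 h2) hij
    · exact fun hv => ⟨Or.inl hv, Or.inl hv⟩
  have hedges : ∀ i j, i ≠ j → ∀ u v, (T i).Adj u v → (T j).Adj u v → False := by
    intro i j hij u v h1 h2
    have hu : u ∈ (S : Set V) := hverts i j hij ▸ ⟨h1.fst_mem, h2.fst_mem⟩
    have hv : v ∈ (S : Set V) := hverts i j hij ▸ ⟨h1.snd_mem, h2.snd_mem⟩
    have e1 := (hE i u v h1).resolve_right (not_not.2 ⟨hu, hv⟩)
    have e2 := (hE j u v h2).resolve_right (not_not.2 ⟨hu, hv⟩)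
    exact hij (e1.trans e2.symm)
  have hinj : Function.Injective T := by
    intro i j hij
    by_contra hne
    -- A tree on at least two vertices has an edge, which equal trees would share.
    obtain ⟨a, ha, b, hb, hab⟩ := Finset.one_lt_card.1 hS
    have ha' : a ∈ (T i).verts := by rw [hV]; exact Or.inl ha
    have hb' : b ∈ (T i).verts := by rw [hV]; exact Or.inl hb
    have : Nontrivial (T i).verts := ⟨⟨a, ha'⟩, ⟨b, hb'⟩, by simpa using hab⟩
    obtain ⟨c, hc⟩ := (hT i).1.preconnected.exists_adj_of_nontrivial ⟨a, ha'⟩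
    have hc' : (T i).Adj a c := hc
    exact hedges i j hne a c hc' (hij ▸ hc')
  let e := (Fintype.equivFin ι).symm
  refine ⟨fun k => T (e k), hinj.comp e.injective, fun k => ⟨hT _, ?_⟩, fun k l hkl => ⟨?_, ?_⟩⟩
  · rw [hV]; exact Set.subset_union_left
  · ext s
    induction s with | _ u v
    simpa using hedges _ _ (e.injective.ne hkl) u v
  · exact hverts _ _ (e.injective.ne hkl)

end Linked

/-! ### Columns between layers -/

section Path

variable {n : ℕ} {W : Type*} {H : SimpleGraph W}

/-- The vertices of the column `w` strictly between the layers `p` and `q`. -/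
def columnBetween (w : W) (p q : Fin n) : Set (Fin n × W) :=
  {v | v.2 = w ∧ (p < v.1 ∧ v.1 < q ∨ q < v.1 ∧ v.1 < p)}

theorem columnBetween_comm (w : W) (p q : Fin n) : columnBetween w p q = columnBetween w q p := by
  ext v
  simp only [columnBetween, Set.mem_ofPred_eq]
  tauto

theorem deleteInside_lexProd_adj_left {S : Set (Fin n × W)} {u v : Fin n × W}
    (h : (pathGraph n).Adj u.1 v.1) (hu : u ∉ S) :
    (((pathGraph n).lexProd H).deleteInside S).Adj u v :=
  ⟨Or.inl h, fun h' => hu h'.1⟩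

theorem deleteInside_lexProd_adj_right {S : Set (Fin n × W)} {u v : Fin n × W}
    (h : (pathGraph n).Adj u.1 v.1) (hv : v ∉ S) :
    (((pathGraph n).lexProd H).deleteInside S).Adj u v :=
  ⟨Or.inl h, fun h' => hv h'.2⟩

/-- The column can be entered from `x` and left to `z` whatever their second coordinates. The gap of
two makes it nonempty, so the walk avoids edges inside `S`. -/
theorem linkedIn_columnBetween_of_lt {S A : Set (Fin n × W)} {w : W} {x z : Fin n × W}
    (hx : x ∈ A) (hz : z ∈ A) (hA : columnBetween w x.1 z.1 ⊆ A)
    (hS : ∀ v ∈ columnBetween w x.1 z.1, v ∉ S) (hgap : x.1.val + 2 ≤ z.1.val) :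
    (((pathGraph n).lexProd H).deleteInside S).LinkedIn A x z ∧
      ∀ v ∈ columnBetween w x.1 z.1,
        (((pathGraph n).lexProd H).deleteInside S).LinkedIn A x v := by
  have hmem : ∀ (t : ℕ) (ht : t < n), x.1.val < t → t < z.1.val →
      ((⟨t, ht⟩, w) : Fin n × W) ∈ columnBetween w x.1 z.1 :=
    fun t ht h1 h2 => ⟨rfl, Or.inl ⟨h1, h2⟩⟩
  have key : ∀ (k : ℕ) (ht : x.1.val + 1 + k < n), x.1.val + 1 + k < z.1.val →
      (((pathGraph n).lexProd H).deleteInside S).LinkedIn A x (⟨x.1.val + 1 + k, ht⟩, w) := by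
    intro k
    induction k with
    | zero =>
      intro ht h
      have hm := hmem _ ht (by omega) h
      refine Adj.linkedIn (deleteInside_lexProd_adj_right ?_ (hS _ hm)) hx (hA hm)
      simp [pathGraph_adj]
    | succ k ih =>
      intro ht h
      have hm := hmem _ ht (by omega) h
      have hm' := hmem (x.1.val + 1 + k) (by omega) (by omega) (by omega)
      refine (ih (by omega) (by omega)).trans
        (Adj.linkedIn (deleteInside_lexProd_adj_right ?_ (hS _ hm)) (hA hm') (hA hm))
      simp only [pathGraph_adj]
      omega
  have hcol : ∀ v ∈ columnBetween w x.1 z.1,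
      (((pathGraph n).lexProd H).deleteInside S).LinkedIn A x v := by
    rintro ⟨t, w'⟩ ⟨rfl, h⟩
    simp only [Fin.lt_def] at h
    have := key (t.val - x.1.val - 1) (by omega) (by omega)
    convert this using 2
    ext
    simp only
    omega
  refine ⟨?_, hcol⟩
  have hm := hmem (z.1.val - 1) (by omega) (by omega) (by omega)
  refine (hcol _ hm).trans (Adj.linkedIn (deleteInside_lexProd_adj_left ?_ (hS _ hm)) (hA hm) hz)
  simp only [pathGraph_adj]
  omega

theorem linkedIn_columnBetween {S A : Set (Fin n × W)} {w : W} {x z : Fin n × W}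
    (hx : x ∈ A) (hz : z ∈ A) (hA : columnBetween w x.1 z.1 ⊆ A)
    (hS : ∀ v ∈ columnBetween w x.1 z.1, v ∉ S)
    (hgap : x.1.val + 2 ≤ z.1.val ∨ z.1.val + 2 ≤ x.1.val) :
    (((pathGraph n).lexProd H).deleteInside S).LinkedIn A x z ∧
      ∀ v ∈ columnBetween w x.1 z.1,
        (((pathGraph n).lexProd H).deleteInside S).LinkedIn A x v := by
  rcases hgap with hgap | hgap
  · exact linkedIn_columnBetween_of_lt hx hz hA hS hgap
  · rw [columnBetween_comm] at hA hS ⊢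
    have := linkedIn_columnBetween_of_lt (H := H) hz hx hA hS hgap
    exact ⟨this.1.symm, fun v hv => this.1.symm.trans (this.2 v hv)⟩

theorem pathGraph_exists_adj (hn : 2 ≤ n) (p : Fin n) : ∃ q, (pathGraph n).Adj p q := by
  by_cases h : p.val + 1 < n
  · exact ⟨⟨p.val + 1, h⟩, by simp [pathGraph_adj]⟩
  · exact ⟨⟨p.val - 1, by omega⟩, by simp only [pathGraph_adj]; omega⟩

theorem pathGraph_lexProd_connected [Nonempty W] (hn : 2 ≤ n) :
    ((pathGraph n).lexProd H).Connected := by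
  have hp : (pathGraph n).Preconnected := by
    obtain ⟨k, rfl⟩ : ∃ k, n = k + 1 := ⟨n - 1, by omega⟩
    exact (pathGraph_connected k).preconnected
  have : Nonempty (Fin n × W) := ⟨(⟨0, by omega⟩, Classical.arbitrary W)⟩
  refine ⟨fun u v => ?_⟩
  obtain ⟨p⟩ := hp u.1 v.1
  have lift : ∀ {s t : Fin n} (_ : (pathGraph n).Walk s t) (w : W),
      ((pathGraph n).lexProd H).Reachable (s, w) (t, w) := by
    intro s t p
    induction p with
    | nil => exact fun w => Reachable.refl _
    | cons h _ ih => exact fun w => (Adj.reachable (Or.inl h)).trans (ih w)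
  -- A detour through a neighbouring layer changes the second coordinate.
  obtain ⟨q, hq⟩ := pathGraph_exists_adj hn v.1
  have h1 : ((pathGraph n).lexProd H).Adj (v.1, u.2) (q, u.2) := Or.inl hq
  have h2 : ((pathGraph n).lexProd H).Adj (q, u.2) (v.1, v.2) := Or.inl hq.symm
  exact (lift p u.2).trans (h1.reachable.trans h2.reachable)

end Path

end SimpleGraph

namespace SimpleGraph

/-! ### Lower bound, by the layers of the three vertices -/

section Cases

theorem exists_perm_of_ne {W : Type*} {a b c d : W} (hab : a ≠ b) (hcd : c ≠ d) :
    ∃ σ : Equiv.Perm W, σ a = c ∧ σ b = d := by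
  classical
  refine ⟨Equiv.swap (Equiv.swap a c b) d * Equiv.swap a c, ?_, by simp⟩
  have h1 : c ≠ Equiv.swap a c b := fun h => hab (by simpa using congrArg (Equiv.swap a c) h)
  simp [Equiv.swap_apply_of_ne_of_ne h1 hcd]

variable {n : ℕ} {W : Type*} [Fintype W] {H : SimpleGraph W}

/-- Three vertices in the same layer. -/
theorem hasDisjointSteinerTrees_of_same_layer (hn : 2 ≤ n) {S : Finset (Fin n × W)}
    (hc : 2 ≤ S.card) {p : Fin n} (hp : ∀ v ∈ S, v.1 = p) :
    ((pathGraph n).lexProd H).HasDisjointSteinerTrees S (Fintype.card W) := by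
  obtain ⟨q, hq⟩ := pathGraph_exists_adj hn p
  obtain ⟨x, hx⟩ : S.Nonempty := Finset.card_pos.1 (by omega)
  have key : ∀ w : W, ((((pathGraph n).lexProd H).deleteInside S).induce
      ((S : Set (Fin n × W)) ∪ {(q, w)})).Connected := by
    intro w
    have hw : ((q, w) : Fin n × W) ∉ (S : Set (Fin n × W)) := fun h => hq.ne (hp _ h).symm
    refine connected_induce_of_linkedIn (u := (q, w)) (Or.inr rfl) ?_
    rintro v (hv | rfl)
    · refine Adj.linkedIn (deleteInside_lexProd_adj_left ?_ hw) (Or.inr rfl) (Or.inl hv)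
      rw [hp v hv]
      exact hq.symm
    · exact LinkedIn.refl (Or.inr rfl)
  -- No tree needs an edge inside `S`, so the exceptional index is arbitrary.
  refine hasDisjointSteinerTrees_of_connected hc x.2 (fun w => {(q, w)}) ?_
    ((key _).mono (comap_monotone _ (deleteInside_le _ _))) (fun w _ => key w)
  rintro w w' v rfl h
  simpa using h

/-- Two vertices in one layer and a third one in a layer that is not adjacent to it. -/
theorem hasDisjointSteinerTrees_of_far_layer {S : Finset (Fin n × W)} (hc : 2 ≤ S.card)
    {x y z : Fin n × W} (hS : ∀ v, v ∈ S ↔ v = x ∨ v = y ∨ v = z) (hxy : x.1 = y.1)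
    (hgap : z.1.val + 2 ≤ x.1.val ∨ x.1.val + 2 ≤ z.1.val) :
    ((pathGraph n).lexProd H).HasDisjointSteinerTrees S (Fintype.card W) := by
  have key : ∀ w : W, ((((pathGraph n).lexProd H).deleteInside S).induce
      ((S : Set (Fin n × W)) ∪ columnBetween w z.1 x.1)).Connected := by
    intro w
    have hout : ∀ v ∈ columnBetween w z.1 x.1, v ∉ (S : Set (Fin n × W)) := by
      rintro v ⟨-, hv⟩ h
      rcases (hS v).1 h with rfl | rfl | rfl
      · omega
      · omega
      · omega
    have hin : ∀ v ∈ S, v ∈ (S : Set (Fin n × W)) ∪ columnBetween w z.1 x.1 :=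
      fun v hv => Or.inl hv
    have hz := hin z ((hS z).2 (by simp))
    have h1 := linkedIn_columnBetween (H := H) hz (hin x ((hS x).2 (by simp)))
      Set.subset_union_right hout hgap
    have h2 := linkedIn_columnBetween (H := H) (w := w) hz (hin y ((hS y).2 (by simp)))
      (by rw [← hxy]; exact Set.subset_union_right) (by rwa [← hxy]) (by rwa [← hxy])
    refine connected_induce_of_linkedIn hz ?_
    rintro v (hv | hv)
    · rcases (hS v).1 hv with rfl | rfl | rfl
      · exact h1.1
      · exact h2.1
      · exact LinkedIn.refl hz
    · exact h1.2 v hv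
  refine hasDisjointSteinerTrees_of_connected hc x.2 _ ?_
    ((key _).mono (comap_monotone _ (deleteInside_le _ _))) (fun w _ => key w)
  rintro w w' v ⟨h, -⟩ ⟨h', -⟩
  exact h.symm.trans h'

/-- Two vertices in one layer and a third one in an adjacent layer. -/
theorem hasDisjointSteinerTrees_of_adj_layer (hH : H.Connected) {S : Finset (Fin n × W)}
    (hc : 2 ≤ S.card)
    {x y z : Fin n × W} (hS : ∀ v, v ∈ S ↔ v = x ∨ v = y ∨ v = z) (hxy : x.1 = y.1)
    (hne : x ≠ y) (hxz : (pathGraph n).Adj x.1 z.1) :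
    ((pathGraph n).lexProd H).HasDisjointSteinerTrees S (Fintype.card W) := by
  have hne2 : x.2 ≠ y.2 := fun h => hne (Prod.ext hxy h)
  have : Nontrivial W := ⟨⟨_, _, hne2⟩⟩
  obtain ⟨z', hz'⟩ := hH.preconnected.exists_adj_of_nontrivial z.2
  obtain ⟨σ, hσ, hσ'⟩ := exists_perm_of_ne hz'.ne hne2
  -- For `w = z.2` nothing is added: the edges `xz`, `yz` suffice. For `w = z'` the vertex `(z.1,
  -- z')` sees `x` and `y`, and `z` by an edge of `H`. Any other `(z.1, w)` reaches `z` through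
  -- `(x.1, σ w)`, and `σ` keeps these vertices off `x` and `y`.
  let B : W → Set (Fin n × W) := fun w => {v | (v.1 = z.1 ∧ v.2 = w ∧ w ≠ z.2) ∨
    (v.1 = x.1 ∧ v.2 = σ w ∧ w ≠ z.2 ∧ w ≠ z')}
  have hin : ∀ w, ∀ v ∈ S, v ∈ (S : Set (Fin n × W)) ∪ B w := fun w v hv => Or.inl hv
  have hx : x ∈ S := (hS x).2 (by simp)
  have hy : y ∈ S := (hS y).2 (by simp)
  have hz : z ∈ S := (hS z).2 (by simp)
  have hyz : (pathGraph n).Adj y.1 z.1 := hxy ▸ hxz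
  refine hasDisjointSteinerTrees_of_connected hc z.2 B ?_ ?_ ?_
  · rintro w w' v (⟨h1, h2, -⟩ | ⟨h1, h2, -⟩) (⟨h3, h4, -⟩ | ⟨h3, h4, -⟩)
    · exact h2.symm.trans h4
    · exact absurd (h3.symm.trans h1) hxz.ne
    · exact absurd (h1.symm.trans h3) hxz.ne
    · exact σ.injective (h2.symm.trans h4)
  · refine connected_induce_of_linkedIn (hin _ z hz) ?_
    rintro v (hv | (⟨-, -, h⟩ | ⟨-, -, h, -⟩))
    · rcases (hS v).1 hv with rfl | rfl | rfl
      · exact Adj.linkedIn (Or.inl hxz.symm) (hin _ _ hz) (hin _ _ hv)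
      · exact Adj.linkedIn (Or.inl hyz.symm) (hin _ _ hz) (hin _ _ hv)
      · exact LinkedIn.refl (hin _ _ hz)
    · exact absurd rfl h
    · exact absurd rfl h
  · intro w hw
    have hb : ((z.1, w) : Fin n × W) ∈ (S : Set (Fin n × W)) ∪ B w := Or.inr (Or.inl ⟨rfl, rfl, hw⟩)
    have hbS : ((z.1, w) : Fin n × W) ∉ (S : Set (Fin n × W)) := by
      intro h
      rcases (hS _).1 h with h | h | h
      · exact hxz.ne (congrArg Prod.fst h).symm
      · exact hyz.ne (congrArg Prod.fst h).symm
      · exact hw (congrArg Prod.snd h)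
    have haz : w ≠ z' → ((x.1, σ w) : Fin n × W) ∈ (S : Set (Fin n × W)) ∪ B w ∧
        ((x.1, σ w) : Fin n × W) ∉ (S : Set (Fin n × W)) := by
      intro hw'
      refine ⟨Or.inr (Or.inr ⟨rfl, rfl, hw, hw'⟩), fun h => ?_⟩
      rcases (hS _).1 h with h | h | h
      · exact hw (σ.injective ((congrArg Prod.snd h).trans hσ.symm))
      · exact hw' (σ.injective ((congrArg Prod.snd h).trans hσ'.symm))
      · exact hxz.ne (congrArg Prod.fst h :)
    have hba : w ≠ z' → (((pathGraph n).lexProd H).deleteInside S).LinkedIn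
        ((S : Set (Fin n × W)) ∪ B w) (z.1, w) (x.1, σ w) := fun hw' =>
      Adj.linkedIn (deleteInside_lexProd_adj_left hxz.symm hbS) hb (haz hw').1
    refine connected_induce_of_linkedIn hb ?_
    rintro ⟨p, v⟩ (hv | (⟨rfl, rfl, -⟩ | ⟨rfl, rfl, -, hw'⟩))
    · rcases (hS _).1 hv with rfl | rfl | rfl
      · exact Adj.linkedIn (deleteInside_lexProd_adj_left hxz.symm hbS) hb (hin _ _ hv)
      · exact Adj.linkedIn (deleteInside_lexProd_adj_left hyz.symm hbS) hb (hin _ _ hv)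
      · by_cases hw' : w = z'
        · subst hw'
          exact Adj.linkedIn ⟨Or.inr ⟨rfl, hz'.symm⟩, fun h => hbS h.1⟩ hb (hin _ _ hv)
        · exact (hba hw').trans
            (Adj.linkedIn (deleteInside_lexProd_adj_left hxz (haz hw').2) (haz hw').1 (hin _ _ hv))
    · exact LinkedIn.refl hb
    · exact hba hw'

/-- Three vertices in different layers, the middle one not adjacent to the outer ones. -/
theorem hasDisjointSteinerTrees_of_gaps {S : Finset (Fin n × W)} (hc : 2 ≤ S.card)
    {x y z : Fin n × W} (hS : ∀ v, v ∈ S ↔ v = x ∨ v = y ∨ v = z)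
    (hlt : x.1 < y.1 ∧ y.1 < z.1 ∨ z.1 < y.1 ∧ y.1 < x.1)
    (hxy : y.1.val + 2 ≤ x.1.val ∨ x.1.val + 2 ≤ y.1.val)
    (hyz : y.1.val + 2 ≤ z.1.val ∨ z.1.val + 2 ≤ y.1.val) :
    ((pathGraph n).lexProd H).HasDisjointSteinerTrees S (Fintype.card W) := by
  have key : ∀ w : W, ((((pathGraph n).lexProd H).deleteInside S).induce
      ((S : Set (Fin n × W)) ∪ (columnBetween w y.1 x.1 ∪ columnBetween w y.1 z.1))).Connected := by
    intro w
    have hout : ∀ v ∈ columnBetween w y.1 x.1 ∪ columnBetween w y.1 z.1,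
        v ∉ (S : Set (Fin n × W)) := by
      rintro v (⟨-, hv⟩ | ⟨-, hv⟩) h <;> rcases (hS v).1 h with rfl | rfl | rfl <;> omega
    have hin : ∀ v ∈ S, v ∈ (S : Set (Fin n × W)) ∪
      (columnBetween w y.1 x.1 ∪ columnBetween w y.1 z.1) := fun v hv => Or.inl hv
    have hy := hin y ((hS y).2 (by simp))
    have h1 := linkedIn_columnBetween (H := H) hy (hin x ((hS x).2 (by simp)))
      (fun v hv => Or.inr (Or.inl hv)) (fun v hv => hout v (Or.inl hv)) hxy
    have h2 := linkedIn_columnBetween (H := H) hy (hin z ((hS z).2 (by simp)))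
      (fun v hv => Or.inr (Or.inr hv)) (fun v hv => hout v (Or.inr hv)) hyz
    refine connected_induce_of_linkedIn hy ?_
    rintro v (hv | (hv | hv))
    · rcases (hS v).1 hv with rfl | rfl | rfl
      · exact h1.1
      · exact LinkedIn.refl hy
      · exact h2.1
    · exact h1.2 v hv
    · exact h2.2 v hv
  refine hasDisjointSteinerTrees_of_connected hc x.2 _ ?_
    ((key _).mono (comap_monotone _ (deleteInside_le _ _))) (fun w _ => key w)
  rintro w w' v (⟨h, -⟩ | ⟨h, -⟩) (⟨h', -⟩ | ⟨h', -⟩) <;> exact h.symm.trans h'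

/-- Three vertices in different layers, the middle one in a layer adjacent to that of an outer
one. -/
theorem hasDisjointSteinerTrees_of_adj_middle {S : Finset (Fin n × W)} (hc : 2 ≤ S.card)
    {x y z : Fin n × W} (hS : ∀ v, v ∈ S ↔ v = x ∨ v = y ∨ v = z)
    (hlt : x.1 < y.1 ∧ y.1 < z.1 ∨ z.1 < y.1 ∧ y.1 < x.1) (hxy : (pathGraph n).Adj x.1 y.1) :
    ((pathGraph n).lexProd H).HasDisjointSteinerTrees S (Fintype.card W) := by
  classical
  let σ : Equiv.Perm W := Equiv.swap y.2 x.2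
  have hσ : σ y.2 = x.2 := Equiv.swap_apply_left _ _
  -- For `w = y.2` the edge `xy` is used. Otherwise `x`, `(y.1, w)`, `(x.1, σ w)`, `y` is a path
  -- avoiding that edge. The vertex `z` is reached from `y` through the column or, if the column is
  -- empty, by a direct edge from layer `y.1`.
  let B : W → Set (Fin n × W) := fun w => {v | (v.1 = y.1 ∧ v.2 = w ∧ w ≠ y.2) ∨
    (v.1 = x.1 ∧ v.2 = σ w ∧ w ≠ y.2) ∨ v ∈ columnBetween w y.1 z.1}
  have hin : ∀ w, ∀ v ∈ S, v ∈ (S : Set (Fin n × W)) ∪ B w := fun w v hv => Or.inl hv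
  have hx : x ∈ S := (hS x).2 (by simp)
  have hy : y ∈ S := (hS y).2 (by simp)
  have hz : z ∈ S := (hS z).2 (by simp)
  have hcase : ((pathGraph n).Adj y.1 z.1 ∧ ∀ (w : W) v, v ∉ columnBetween w y.1 z.1) ∨
      (y.1.val + 2 ≤ z.1.val ∨ z.1.val + 2 ≤ y.1.val) := by
    by_cases h : (pathGraph n).Adj y.1 z.1
    · refine Or.inl ⟨h, fun w v hv => ?_⟩
      have := hv.2
      rw [pathGraph_adj] at h
      omega
    · rw [pathGraph_adj] at h
      omega
  have hgap : (y.1.val + 2 ≤ z.1.val ∨ z.1.val + 2 ≤ y.1.val) → ∀ w,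
      (((pathGraph n).lexProd H).deleteInside S).LinkedIn ((S : Set (Fin n × W)) ∪ B w) y z ∧
      ∀ v ∈ columnBetween w y.1 z.1, (((pathGraph n).lexProd H).deleteInside S).LinkedIn
        ((S : Set (Fin n × W)) ∪ B w) y v := by
    intro h w
    refine linkedIn_columnBetween (hin _ _ hy) (hin _ _ hz) (fun v hv => Or.inr (Or.inr (Or.inr hv)))
      ?_ h
    rintro v ⟨-, hv⟩ h
    rcases (hS v).1 h with rfl | rfl | rfl <;> omega
  refine hasDisjointSteinerTrees_of_connected hc y.2 B ?_ ?_ ?_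
  · rintro w w' v (⟨h1, h2, -⟩ | ⟨h1, h2, -⟩ | ⟨h1, h2⟩) (⟨h3, h4, -⟩ | ⟨h3, h4, -⟩ | ⟨h3, h4⟩)
    · exact h2.symm.trans h4
    · exact absurd (h3.symm.trans h1) hxy.ne
    · omega
    · exact absurd (h1.symm.trans h3) hxy.ne
    · exact σ.injective (h2.symm.trans h4)
    · omega
    · omega
    · omega
    · exact h1.symm.trans h3
  · refine connected_induce_of_linkedIn (hin _ y hy) ?_
    rintro v (hv | (⟨-, -, h⟩ | ⟨-, -, h⟩ | h))
    · rcases (hS v).1 hv with rfl | rfl | rfl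
      · exact Adj.linkedIn (Or.inl hxy.symm) (hin _ _ hy) (hin _ _ hv)
      · exact LinkedIn.refl (hin _ _ hv)
      · rcases hcase with h | h
        · exact Adj.linkedIn (Or.inl h.1) (hin _ _ hy) (hin _ _ hv)
        · exact (hgap h _).1.mono (deleteInside_le _ _)
    · exact absurd rfl h
    · exact absurd rfl h
    · rcases hcase with h' | h'
      · exact absurd h (h'.2 _ _)
      · exact ((hgap h' _).2 v h).mono (deleteInside_le _ _)
  · intro w hw
    have hb : ((y.1, w) : Fin n × W) ∈ (S : Set (Fin n × W)) ∪ B w := Or.inr (Or.inl ⟨rfl, rfl, hw⟩)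
    have ha : ((x.1, σ w) : Fin n × W) ∈ (S : Set (Fin n × W)) ∪ B w :=
      Or.inr (Or.inr (Or.inl ⟨rfl, rfl, hw⟩))
    have hbS : ((y.1, w) : Fin n × W) ∉ (S : Set (Fin n × W)) := by
      intro h
      rcases (hS _).1 h with h | h | h
      · exact hxy.ne (congrArg Prod.fst h).symm
      · exact hw (congrArg Prod.snd h)
      · have := congrArg Prod.fst h
        simp only at this
        omega
    have haS : ((x.1, σ w) : Fin n × W) ∉ (S : Set (Fin n × W)) := by
      intro h
      rcases (hS _).1 h with h | h | h
      · exact hw (σ.injective ((congrArg Prod.snd h).trans hσ.symm))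
      · exact hxy.ne (congrArg Prod.fst h :)
      · have := congrArg Prod.fst h
        simp only at this
        omega
    have hya : (((pathGraph n).lexProd H).deleteInside S).LinkedIn ((S : Set (Fin n × W)) ∪ B w)
        y (x.1, σ w) := Adj.linkedIn (deleteInside_lexProd_adj_right hxy.symm haS) (hin _ _ hy) ha
    have hyb : (((pathGraph n).lexProd H).deleteInside S).LinkedIn ((S : Set (Fin n × W)) ∪ B w)
        y (y.1, w) := hya.trans (Adj.linkedIn (deleteInside_lexProd_adj_right hxy hbS) ha hb)
    refine connected_induce_of_linkedIn (hin _ y hy) ?_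
    rintro v (hv | (⟨h1, h2, -⟩ | ⟨h1, h2, -⟩ | h))
    · rcases (hS _).1 hv with rfl | rfl | rfl
      · exact hyb.trans (Adj.linkedIn (deleteInside_lexProd_adj_left hxy.symm hbS) hb (hin _ _ hv))
      · exact LinkedIn.refl (hin _ _ hv)
      · rcases hcase with h | h
        · exact hyb.trans (Adj.linkedIn (deleteInside_lexProd_adj_left h.1 hbS) hb (hin _ _ hv))
        · exact (hgap h _).1
    · obtain rfl : v = (y.1, w) := Prod.ext h1 h2
      exact hyb
    · obtain rfl : v = (x.1, σ w) := Prod.ext h1 h2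
      exact hya
    · rcases hcase with h' | h'
      · exact absurd h (h'.2 _ _)
      · exact (hgap h' _).2 v h

theorem pathGraph_adj_or_gap {p q : Fin n} (h : p ≠ q) :
    (pathGraph n).Adj p q ∨ (q.val + 2 ≤ p.val ∨ p.val + 2 ≤ q.val) := by
  rw [pathGraph_adj]
  omega

theorem hasDisjointSteinerTrees_of_layer_eq (hn : 2 ≤ n) (hH : H.Connected)
    {S : Finset (Fin n × W)} (hc : 2 ≤ S.card)
    {x y z : Fin n × W} (hS : ∀ v, v ∈ S ↔ v = x ∨ v = y ∨ v = z) (hxy : x.1 = y.1)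
    (hne : x ≠ y) :
    ((pathGraph n).lexProd H).HasDisjointSteinerTrees S (Fintype.card W) := by
  by_cases hxz : x.1 = z.1
  · refine hasDisjointSteinerTrees_of_same_layer hn hc (p := x.1) fun v hv => ?_
    rcases (hS v).1 hv with rfl | rfl | rfl
    · rfl
    · exact hxy.symm
    · exact hxz.symm
  · rcases pathGraph_adj_or_gap hxz with h | h
    · exact hasDisjointSteinerTrees_of_adj_layer hH hc hS hxy hne h
    · exact hasDisjointSteinerTrees_of_far_layer hc hS hxy h

theorem hasDisjointSteinerTrees_of_layer_between {S : Finset (Fin n × W)} (hc : 2 ≤ S.card)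
    {x y z : Fin n × W} (hS : ∀ v, v ∈ S ↔ v = x ∨ v = y ∨ v = z)
    (hlt : x.1 < y.1 ∧ y.1 < z.1 ∨ z.1 < y.1 ∧ y.1 < x.1) :
    ((pathGraph n).lexProd H).HasDisjointSteinerTrees S (Fintype.card W) := by
  rcases pathGraph_adj_or_gap (show x.1 ≠ y.1 by omega) with h | h
  · exact hasDisjointSteinerTrees_of_adj_middle hc hS hlt h
  rcases pathGraph_adj_or_gap (show z.1 ≠ y.1 by omega) with h' | h'
  · refine hasDisjointSteinerTrees_of_adj_middle (x := z) (y := y) (z := x) hc ?_ hlt.symm h'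
    intro v
    rw [hS]
    tauto
  · exact hasDisjointSteinerTrees_of_gaps hc hS hlt h h'

theorem hasDisjointSteinerTrees_lexProd (hn : 2 ≤ n) (hH : H.Connected)
    {S : Finset (Fin n × W)} (hc : S.card = 3) :
    ((pathGraph n).lexProd H).HasDisjointSteinerTrees S (Fintype.card W) := by
  classical
  obtain ⟨x, y, z, hxy, hxz, hyz, rfl⟩ := Finset.card_eq_three.1 hc
  have hc' : 2 ≤ ({x, y, z} : Finset (Fin n × W)).card := by omega
  have h1 : ∀ v, v ∈ ({x, y, z} : Finset (Fin n × W)) ↔ v = x ∨ v = y ∨ v = z := by simp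
  have h2 : ∀ v, v ∈ ({x, y, z} : Finset (Fin n × W)) ↔ v = x ∨ v = z ∨ v = y :=
    fun v => (h1 v).trans (by tauto)
  have h3 : ∀ v, v ∈ ({x, y, z} : Finset (Fin n × W)) ↔ v = y ∨ v = z ∨ v = x :=
    fun v => (h1 v).trans (by tauto)
  have h4 : ∀ v, v ∈ ({x, y, z} : Finset (Fin n × W)) ↔ v = y ∨ v = x ∨ v = z :=
    fun v => (h1 v).trans (by tauto)
  by_cases e1 : x.1 = y.1
  · exact hasDisjointSteinerTrees_of_layer_eq hn hH hc' h1 e1 hxy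
  by_cases e2 : x.1 = z.1
  · exact hasDisjointSteinerTrees_of_layer_eq hn hH hc' h2 e2 hxz
  by_cases e3 : y.1 = z.1
  · exact hasDisjointSteinerTrees_of_layer_eq hn hH hc' h3 e3 hyz
  by_cases b1 : x.1 < y.1 ∧ y.1 < z.1 ∨ z.1 < y.1 ∧ y.1 < x.1
  · exact hasDisjointSteinerTrees_of_layer_between hc' h1 b1
  by_cases b2 : x.1 < z.1 ∧ z.1 < y.1 ∨ y.1 < z.1 ∧ z.1 < x.1
  · exact hasDisjointSteinerTrees_of_layer_between hc' h2 b2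
  · exact hasDisjointSteinerTrees_of_layer_between hc' h4 (by omega)

theorem card_le_genConn_lexProd (hn : 2 ≤ n) (hH : H.Connected) :
    Fintype.card W ≤ ((pathGraph n).lexProd H).genConn 3 := by
  have := hH.nonempty
  rw [genConn, if_neg (not_not.2 (pathGraph_lexProd_connected hn))]
  split_ifs with h
  -- Here the conventional value is `1`, and `n * |W| < 3` with `2 ≤ n` forces `|W| ≤ 1`.
  · rw [Fintype.card_prod, Fintype.card_fin] at h
    nlinarith
  · refine le_csInf ?_ ?_
    · obtain ⟨S, -, hS⟩ := Finset.exists_subset_card_eq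
        (s := (Finset.univ : Finset (Fin n × W))) (n := 3) (by simpa using h)
      exact ⟨_, S, hS, rfl⟩
    · rintro r ⟨S, hS, rfl⟩
      exact (isGreatest_genLocalConn _ S).2 (hasDisjointSteinerTrees_lexProd hn hH hS)

end Cases

/-! ### Upper bound, by a separating layer -/

section Cut

variable {V : Type*} {G : SimpleGraph V} {S : Finset V} {r : ℕ}

/-- If every connected set containing `S` meets a set `C` disjoint from `S`, then there are at most
`|C|` internally disjoint `S`-trees. -/
theorem HasDisjointSteinerTrees.le_card (h : G.HasDisjointSteinerTrees S r) {C : Finset V}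
    (hCS : ∀ v ∈ C, v ∉ S)
    (hC : ∀ A : Set V, (S : Set V) ⊆ A → (G.induce A).Preconnected → ∃ v ∈ C, v ∈ A) :
    r ≤ C.card := by
  obtain ⟨T, -, hT, hdisj⟩ := h
  have hex : ∀ i, ∃ v ∈ C, v ∈ (T i).verts := fun i => by
    refine hC _ (hT i).2 ((hT i).1.connected.preconnected.mono ?_)
    exact fun a b hab => (T i).adj_sub hab
  choose f hf hfT using hex
  have hinj : Function.Injective f := by
    intro i j hij
    by_contra hne
    have : f i ∈ (S : Set V) := by
      rw [← (hdisj i j hne).2]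
      exact ⟨hfT i, hij ▸ hfT j⟩
    exact hCS _ (hf i) this
  simpa using Finset.card_le_card_of_injOn f (s := Finset.univ) (t := C)
    (fun i _ => hf i) hinj.injOn

/-- A layer of `P_n ∘ H` separates the layers before it from those after it. -/
theorem exists_mem_layer_of_preconnected {n : ℕ} {W : Type*} {H : SimpleGraph W}
    {A : Set (Fin n × W)} (hA : (((pathGraph n).lexProd H).induce A).Preconnected)
    {u v : Fin n × W} (hu : u ∈ A) (hv : v ∈ A) {p : Fin n} (hup : u.1 < p) (hpv : p < v.1) :
    ∃ w ∈ A, w.1 = p := by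
  by_contra! hcon
  obtain ⟨q⟩ := hA ⟨u, hu⟩ ⟨v, hv⟩
  have key : ∀ {a b : A} (_ : (((pathGraph n).lexProd H).induce A).Walk a b),
      a.1.1 < p → b.1.1 < p := by
    intro a b q
    induction q with
    | nil => exact id
    -- An edge changes the layer by at most one, so a walk avoiding layer `p` cannot cross it.
    | @cons a b c hab _ ih =>
      intro ha
      have hb := hcon b.1 b.2
      refine ih ?_
      have hab' : ((pathGraph n).lexProd H).Adj a.1 b.1 := hab
      rcases hab' with h | ⟨h, -⟩
      · rw [pathGraph_adj] at h
        omega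
      · rwa [← h]
  exact absurd (key q hup) (not_lt.2 hpv.le)

end Cut

/-- A pair of vertices in layer `2` and one in layer `0` are separated by layer `1`. -/
theorem genConn_lexProd_le {n : ℕ} {W : Type*} [Fintype W] {H : SimpleGraph W} (hn : 3 ≤ n)
    [Nontrivial W] : ((pathGraph n).lexProd H).genConn 3 ≤ Fintype.card W := by
  classical
  obtain ⟨a, b, hab⟩ := exists_pair_ne W
  let l : ∀ k, k < 3 → Fin n := fun k hk => ⟨k, by omega⟩
  let S : Finset (Fin n × W) := {(l 0 (by omega), a), (l 2 (by omega), a), (l 2 (by omega), b)}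
  have hS : S.card = 3 := by
    rw [Finset.card_eq_three]
    exact ⟨_, _, _, by simp [l], by simp [l], by simpa using hab, rfl⟩
  rw [genConn, if_neg (not_not.2 (pathGraph_lexProd_connected (by omega))), if_neg]
  · have hle : sInf {r : ℕ | ∃ S : Finset (Fin n × W), S.card = 3 ∧
        r = ((pathGraph n).lexProd H).genLocalConn S} ≤ ((pathGraph n).lexProd H).genLocalConn S :=
      Nat.sInf_le ⟨S, hS, rfl⟩
    refine hle.trans ?_
    have h := (isGreatest_genLocalConn ((pathGraph n).lexProd H) S).1
    have := HasDisjointSteinerTrees.le_card h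
      (C := Finset.univ.image fun w : W => (l 1 (by omega), w))
      ?_ ?_
    · exact this.trans Finset.card_image_le
    · intro v hv
      simp only [Finset.mem_image, Finset.mem_univ, true_and] at hv
      obtain ⟨w, rfl⟩ := hv
      simp [S, l]
    · intro A hSA hA
      obtain ⟨w, hw, hw1⟩ := exists_mem_layer_of_preconnected hA (p := l 1 (by omega))
        (u := (l 0 (by omega), a)) (v := (l 2 (by omega), a)) (hSA (by simp [S]))
        (hSA (by simp [S])) (by simp [l, Fin.lt_def]) (by simp [l, Fin.lt_def])
      refine ⟨w, ?_, hw⟩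
      simp only [Finset.mem_image, Finset.mem_univ, true_and]
      exact ⟨w.2, Prod.ext hw1.symm rfl⟩
  · rw [not_lt, ← hS]
    exact Finset.card_le_univ S

end SimpleGraph

theorem proposition2p3 :
    (∀ (W : Type*) [Fintype W] (H : SimpleGraph W) (n : ℕ), H.Connected → 2 ≤ n →
      Fintype.card W ≤ ((SimpleGraph.pathGraph n).lexProd H).genConn 3) ∧
    (∀ n : ℕ, 4 ≤ n →
      ((SimpleGraph.pathGraph n).lexProd (SimpleGraph.pathGraph 3)).genConn 3 =
        Fintype.card (Fin 3)) := by
  refine ⟨fun W _ H n hH hn => SimpleGraph.card_le_genConn_lexProd hn hH, fun n hn => ?_⟩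
  exact le_antisymm (SimpleGraph.genConn_lexProd_le (by omega))
    (SimpleGraph.card_le_genConn_lexProd (by omega) (SimpleGraph.pathGraph_connected 2))
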